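/- A Hermitian symmetric space is a connected (Hausdorff, finite-dimensional) complex manifold with a smooth Hermitian metric such that every point is an isolated fixed point of an involutive holomorphic isometry. A real form of it is the fixed-point set $B=\{p:\sigma(p)=p\}$ of an involutive antiholomorphic isometry $\sigma$; $\sigma$ is then called the involutive isometry of $B$. Theorem 6.1. Let $f\colon M\to N$ be a holomorphic map between Hermitian symmetric spaces, and let $B_1$ and $B_2$ be real forms of $M$ and $N$ with involutive isometries $\sigma_1$ and $\sigma_2$ respectively, such that $f(B_1)\subset B_2$. Let $H$ be a nonempty smooth (embedded) real hypersurface of $M$, i.e. a submanifold of real codimension one, such that $B_1\subset H$ and $\sigma_1(H)=H$. Suppose furthermore that 1. $f(\sigma_1(p))=\sigma_2(f(p))$ for all $p\in H$, and 2. $f_*(\sigma_{1*}(v))=\sigma_{2*}(f_*(v))$ for all $p\in H$ and all $v\in T_pH$. Then $f(\sigma_1(p))=\sigma_2(f(p))$ for all $p\in M$. -/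

import Mathlib

open Manifold ContDiff Topology

/-- A complex manifold (holomorphic transition maps) is in particular a real analytic, hence smooth,
manifold over the same model space, regarded as a real vector space. -/
instance instIsManifoldRealOfComplex {E : Type*} [NormedAddCommGroup E] [NormedSpace ℂ E]
    {M : Type*} [TopologicalSpace M] [ChartedSpace E M] [IsManifold 𝓘(ℂ, E) ω M] :
    IsManifold 𝓘(ℝ, E) ω M := by
  apply isManifold_of_contDiffOn
  intro e e' he he'
  have h := (contDiffGroupoid ω 𝓘(ℂ, E)).compatible he he'
  rw [contDiffGroupoid, mem_groupoid_of_pregroupoid] at h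
  exact h.1.restrict_scalars ℝ

/-- A smooth Riemannian metric on (the underlying real manifold of) a complex manifold `M`. -/
abbrev SmoothRiemannianMetric (E : Type*) [NormedAddCommGroup E] [NormedSpace ℂ E]
    (M : Type*) [TopologicalSpace M] [ChartedSpace E M] [IsManifold 𝓘(ℂ, E) ω M] : Type _ :=
  Bundle.ContMDiffRiemannianMetric 𝓘(ℝ, E) ∞ E (fun x : M => TangentSpace 𝓘(ℝ, E) x)

section Structures

variable {E : Type*} [NormedAddCommGroup E] [NormedSpace ℂ E]
  {M : Type*} [TopologicalSpace M] [ChartedSpace E M]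

/-- The complex structure `J` on the real tangent space `T_p M` of a complex manifold. The tangent
space is the model space `E`, read in the preferred chart at `p`, which is a holomorphic chart;
so `J` is multiplication by `i`. -/
def complexStructure (p : M) (v : TangentSpace 𝓘(ℝ, E) p) : TangentSpace 𝓘(ℝ, E) p :=
  (Complex.I • (show E from v) : E)

/-- A (real differentiable) self-map whose differential anticommutes with `J`. -/
def IsAntiholomorphic (E : Type*) [NormedAddCommGroup E] [NormedSpace ℂ E]
    {M : Type*} [TopologicalSpace M] [ChartedSpace E M] (σ : M → M) : Prop :=
  MDifferentiable 𝓘(ℝ, E) 𝓘(ℝ, E) σ ∧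
    ∀ (p : M) (v : TangentSpace 𝓘(ℝ, E) p),
      mfderiv 𝓘(ℝ, E) 𝓘(ℝ, E) σ p (complexStructure p v) =
        -complexStructure (σ p) (mfderiv 𝓘(ℝ, E) 𝓘(ℝ, E) σ p v)

/-- A smooth involution of `M` (hence a diffeomorphism) that preserves the metric `g`. -/
structure IsInvolutiveIsometry [IsManifold 𝓘(ℂ, E) ω M] (g : SmoothRiemannianMetric E M)
    (σ : M → M) : Prop where
  involutive : Function.Involutive σ
  smooth : ContMDiff 𝓘(ℝ, E) 𝓘(ℝ, E) ∞ σ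
  isometry : ∀ (p : M) (v w : TangentSpace 𝓘(ℝ, E) p),
    g.inner (σ p) (mfderiv 𝓘(ℝ, E) 𝓘(ℝ, E) σ p v) (mfderiv 𝓘(ℝ, E) 𝓘(ℝ, E) σ p w) =
      g.inner p v w

/-- `(M, g)` is a Hermitian symmetric space: `M` is a connected complex manifold, `g` is a Hermitian
metric (`J` is orthogonal for `g`), and every point of `M` is an isolated fixed point of an
involutive holomorphic isometry. -/
structure IsHermitianSymmetric [IsManifold 𝓘(ℂ, E) ω M] (g : SmoothRiemannianMetric E M) :
    Prop where
  connected : ConnectedSpace M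
  hermitian : ∀ (p : M) (v w : TangentSpace 𝓘(ℝ, E) p),
    g.inner p (complexStructure p v) (complexStructure p w) = g.inner p v w
  symmetric : ∀ p : M, ∃ s : M → M, IsInvolutiveIsometry g s ∧
    MDifferentiable 𝓘(ℂ, E) 𝓘(ℂ, E) s ∧ s p = p ∧ ∀ᶠ q in 𝓝[≠] p, s q ≠ q

/-- `B` is the real form of `(M, g)` defined by `σ`: `σ` is an involutive antiholomorphic isometry
and `B` is its fixed-point set. -/
structure IsRealForm [IsManifold 𝓘(ℂ, E) ω M] (g : SmoothRiemannianMetric E M)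
    (σ : M → M) (B : Set M) : Prop where
  involutiveIsometry : IsInvolutiveIsometry g σ
  antiholomorphic : IsAntiholomorphic E σ
  eq_fixedPoints : B = Function.fixedPoints σ

/-- `H` is a (smooth, embedded) real hypersurface of `M`: near each of its points it is the zero set
of a smooth real function with nowhere vanishing differential. -/
def IsRealHypersurface (E : Type*) [NormedAddCommGroup E] [NormedSpace ℂ E]
    {M : Type*} [TopologicalSpace M] [ChartedSpace E M] (H : Set M) : Prop :=
  ∀ p ∈ H, ∃ (U : Set M) (ρ : M → ℝ), IsOpen U ∧ p ∈ U ∧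
    ContMDiffOn 𝓘(ℝ, E) 𝓘(ℝ, ℝ) ∞ ρ U ∧
    (∀ q ∈ U, mfderiv 𝓘(ℝ, E) 𝓘(ℝ, ℝ) ρ q ≠ 0) ∧
    ∀ q ∈ U, q ∈ H ↔ ρ q = 0

/-- The tangent space `T_p H` of a submanifold `H` of `M`: the vectors of `T_p M` killed by the
differential of every smooth function, defined near `p`, that vanishes on `H`. -/
def submanifoldTangentSpace (H : Set M) (p : M) : Set (TangentSpace 𝓘(ℝ, E) p) :=
  {v | ∀ (U : Set M) (ρ : M → ℝ), IsOpen U → p ∈ U →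
    ContMDiffOn 𝓘(ℝ, E) 𝓘(ℝ, ℝ) ∞ ρ U → (∀ q ∈ U, q ∈ H → ρ q = 0) →
    mfderiv 𝓘(ℝ, E) 𝓘(ℝ, ℝ) ρ p v = 0}

end Structures

/-! Conjugating `f` by the two antiholomorphic involutions gives `σ₂ ∘ f ∘ σ₁`, which is again
holomorphic, and the claim is that it equals `f`. Condition 1 says exactly that the two maps agree
on `H`.

A real hypersurface is large enough to determine a holomorphic map. Every complex line in a fixed
transverse direction, passing close to a point of `H`, meets `H` in infinitely many points of a
compact set, so the one-variable identity theorem applies along it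
(`eventuallyEq_zero_of_vanishing_on_hypersurface`). Agreement near one point of `H` then spreads
over the connected manifold `M` (`MDifferentiable.eq_of_eventuallyEq_complex`). -/

/-- The points of a complex affine line lying in a convex set form a convex set. -/
theorem Convex.preimage_complex_line {E : Type*} [NormedAddCommGroup E] [NormedSpace ℂ E]
    {W : Set E} (hW : Convex ℝ W) (q v : E) :
    Convex ℝ ((fun t : ℂ => q + t • v) ⁻¹' W) := by
  intro a ha b hb s t hs ht hst
  have e : q + (s • a + t • b) • v = s • (q + a • v) + t • (q + b • v) := by
    have : q = (s + t) • q := by rw [hst, one_smul]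
    nth_rw 1 [this]
    simp only [add_smul, smul_add, smul_assoc]
    abel
  simpa only [Set.mem_preimage, e] using hW ha hb hs ht hst

/-- A holomorphic map is analytic along every complex affine line. -/
theorem DifferentiableOn.analyticOnNhd_complex_line
    {E F : Type*} [NormedAddCommGroup E] [NormedSpace ℂ E] [NormedAddCommGroup F]
    [NormedSpace ℂ F] [CompleteSpace F] {W : Set E} {h : E → F} (hd : DifferentiableOn ℂ h W)
    (hW : IsOpen W) (q v : E) :
    AnalyticOnNhd ℂ (fun t : ℂ => h (q + t • v)) ((fun t : ℂ => q + t • v) ⁻¹' W) := by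
  have hl : Differentiable ℂ fun t : ℂ => q + t • v := by fun_prop
  exact (hd.comp hl.differentiableOn fun _ ht => ht).analyticOnNhd (hW.preimage hl.continuous)

/-- A holomorphic map on a convex open set that vanishes near a point vanishes identically. -/
theorem DifferentiableOn.eqOn_zero_of_convex_of_eventuallyEq_zero
    {E F : Type*} [NormedAddCommGroup E] [NormedSpace ℂ E] [NormedAddCommGroup F]
    [NormedSpace ℂ F] [CompleteSpace F] {W : Set E} {h : E → F} (hd : DifferentiableOn ℂ h W)
    (hW : IsOpen W) (hc : Convex ℝ W) {y : E} (hy : y ∈ W) (h0 : h =ᶠ[𝓝 y] 0) :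
    Set.EqOn h 0 W := by
  intro z hz
  have hl : Differentiable ℂ fun t : ℂ => y + t • (z - y) := by fun_prop
  set S : Set ℂ := (fun t : ℂ => y + t • (z - y)) ⁻¹' W with hS
  have hSc : Convex ℝ S := hc.preimage_complex_line y (z - y)
  have hk := hd.analyticOnNhd_complex_line hW y (z - y)
  have h00 : (0 : ℂ) ∈ S := by simpa [hS] using hy
  have h1 : (1 : ℂ) ∈ S := by simpa [hS] using hz
  have hev : (fun t : ℂ => h (y + t • (z - y))) =ᶠ[𝓝 0] 0 := by
    have ht : Filter.Tendsto (fun t : ℂ => y + t • (z - y)) (𝓝 0) (𝓝 y) := by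
      simpa using hl.continuous.tendsto 0
    exact ht.eventually h0
  simpa using hk.eqOn_zero_of_preconnected_of_eventuallyEq_zero hSc.isPreconnected h00 hev h1

/-! ### Real hypersurfaces as uniqueness sets in a vector space -/

/-- A holomorphic map that vanishes on a real hypersurface through `p` vanishes near `p`. -/
theorem eventuallyEq_zero_of_vanishing_on_hypersurface
    {E F : Type*} [NormedAddCommGroup E] [NormedSpace ℂ E] [NormedAddCommGroup F]
    [NormedSpace ℂ F] [CompleteSpace F] {h : E → F} {ρ : E → ℝ} {p : E} {L : E →L[ℝ] ℝ}
    (hd : ∀ᶠ q in 𝓝 p, DifferentiableAt ℂ h q) (hρc : ∀ᶠ q in 𝓝 p, ContinuousAt ρ q)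
    (hρ : HasFDerivAt ρ L p) (hL : L ≠ 0) (hρ0 : ρ p = 0)
    (hz : ∀ᶠ q in 𝓝 p, ρ q = 0 → h q = 0) : h =ᶠ[𝓝 p] 0 := by
  obtain ⟨v, hv⟩ : ∃ v, 0 < L v := by
    obtain ⟨w, hw⟩ : ∃ w, L w ≠ 0 := by
      by_contra! hcon
      exact hL (ContinuousLinearMap.ext hcon)
    rcases lt_or_gt_of_ne hw with hw | hw
    · exact ⟨-w, by simpa using hw⟩
    · exact ⟨w, hw⟩
  obtain ⟨r, hr, hball⟩ := Metric.eventually_nhds_iff_ball.1 (hd.and (hρc.and hz))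
  have hline : HasDerivAt (fun s : ℝ => ρ (p + s • v)) (L v) 0 := by
    have h1 : HasDerivAt (fun s : ℝ => p + s • v) v 0 := by
      simpa using ((hasDerivAt_id (0 : ℝ)).smul_const v).const_add p
    have h2 : HasFDerivAt ρ L (p + (0 : ℝ) • v) := by simpa using hρ
    exact h2.comp_hasDerivAt 0 h1
  have hslope : ∀ᶠ s : ℝ in 𝓝[≠] 0, 0 < s⁻¹ * ρ (p + s • v) := by
    have := (hasDerivAt_iff_tendsto_slope.1 hline).eventually (lt_mem_nhds hv)
    simpa [slope_def_field, hρ0, div_eq_inv_mul] using this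
  obtain ⟨d, hdpos, hd'⟩ := Metric.eventually_nhds_iff_ball.1 (eventually_nhdsWithin_iff.1 hslope)
  -- The factor 4 leaves room for `q` within `r / 2` of `p` plus a displacement `t • v` with `‖t‖ ≤
  -- 2 * ε`.
  obtain ⟨ε, hε, hεd, hεr⟩ : ∃ ε : ℝ, 0 < ε ∧ ε < d ∧ 4 * ε * ‖v‖ < r := by
    have h1 : ∀ᶠ ε : ℝ in 𝓝[>] 0, ε < d := nhdsWithin_le_nhds (gt_mem_nhds hdpos)
    have h2 : ∀ᶠ ε : ℝ in 𝓝[>] 0, 4 * ε * ‖v‖ < r := by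
      refine nhdsWithin_le_nhds ?_
      have : Continuous fun ε : ℝ => 4 * ε * ‖v‖ := by fun_prop
      exact this.continuousAt.eventually_lt continuousAt_const (by simpa using hr)
    obtain ⟨ε, ⟨h1, h2⟩, h3⟩ := ((h1.and h2).and self_mem_nhdsWithin).exists
    exact ⟨ε, h3, h1, h2⟩
  have hpos : 0 < ρ (p + ε • v) := by
    have := hd' ε (by simpa [abs_of_pos hε] using hεd) hε.ne'
    exact (mul_pos_iff_of_pos_left (inv_pos.2 hε)).1 this
  have hneg : ρ (p + (-ε) • v) < 0 := by
    have := hd' (-ε) (by simpa [abs_of_pos hε] using hεd) (by simpa using hε.ne')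
    rw [inv_neg, neg_mul, ← mul_neg, mul_pos_iff_of_pos_left (inv_pos.2 hε)] at this
    linarith
  have hmem : ∀ s : ℝ, |s| ≤ ε → p + s • v ∈ Metric.ball p r := by
    intro s hs
    rw [mem_ball_iff_norm, add_sub_cancel_left, norm_smul, Real.norm_eq_abs]
    nlinarith [norm_nonneg v]
  -- `G s (q, τ)` is the point of parameter `s + iτ` on the complex line through `q` in the
  -- transverse direction `v`.
  set G : ℝ → E × ℝ → E := fun s x => x.1 + ((s : ℂ) + x.2 * Complex.I) • v with hG
  have hGc : ∀ s, Continuous (G s) := fun s => by simp only [hG]; fun_prop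
  have hG0 : ∀ s, G s (p, 0) = p + s • v := fun s => by simp [hG]
  have hcont : ∀ s : ℝ, |s| ≤ ε → ContinuousAt (fun x => ρ (G s x)) (p, 0) := fun s hs => by
    refine ContinuousAt.comp (g := ρ) ?_ (hGc s).continuousAt
    rw [hG0]
    exact (hball _ (hmem s hs)).2.1
  -- The signs of `ρ` at the endpoints `s = ±ε` are open conditions, so they persist for `q` near
  -- `p` and `τ` near 0.
  have e1 : ∀ᶠ x in 𝓝 ((p, 0) : E × ℝ), 0 < ρ (G ε x) :=
    (hcont ε (abs_of_pos hε).le).eventually_const_lt (by simpa only [hG0] using hpos)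
  have e2 : ∀ᶠ x in 𝓝 ((p, 0) : E × ℝ), ρ (G (-ε) x) < 0 :=
    (hcont (-ε) (by simp [abs_of_pos hε])).eventually_lt_const (by simpa only [hG0] using hneg)
  rw [nhds_prod_eq] at e1 e2
  obtain ⟨P, hP, Q, hQ, hPQ⟩ := Filter.eventually_prod_iff.1 (e1.and e2)
  obtain ⟨δ, hδ, hδQ⟩ := Metric.eventually_nhds_iff_ball.1 hQ
  filter_upwards [hP, Metric.ball_mem_nhds p (half_pos hr)] with q hqP hqr
  set S : Set ℂ := (fun t : ℂ => q + t • v) ⁻¹' Metric.ball p r with hS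
  have hSc : Convex ℝ S := (convex_ball p r).preimage_complex_line q v
  have hk := DifferentiableOn.analyticOnNhd_complex_line (h := h)
    (fun x hx => (hball x hx).1.differentiableWithinAt) Metric.isOpen_ball q v
  have hrect : ∀ t : ℂ, |t.re| ≤ ε → |t.im| ≤ ε → t ∈ S := by
    intro t h1 h2
    have h3 : ‖t‖ ≤ 2 * ε := (Complex.norm_le_abs_re_add_abs_im t).trans (by linarith)
    have h4 : ‖q - p‖ < r / 2 := mem_ball_iff_norm.1 hqr
    simp only [hS, Set.mem_preimage]
    rw [mem_ball_iff_norm]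
    calc ‖q + t • v - p‖ = ‖(q - p) + t • v‖ := by congr 1; abel
      _ ≤ ‖q - p‖ + ‖t • v‖ := norm_add_le _ _
      _ = ‖q - p‖ + ‖t‖ * ‖v‖ := by rw [norm_smul]
      _ < r := by nlinarith [norm_nonneg v]
  set η := min (δ / 2) ε with hη
  have hηpos : 0 < η := lt_min (half_pos hδ) hε
  -- For each height `τ`, `ρ` changes sign along the horizontal segment, so it vanishes somewhere on
  -- it, and `h` vanishes there too.
  have hzero : ∀ τ ∈ Set.Icc 0 η, ∃ t : ℂ, |t.re| ≤ ε ∧ t.im = τ ∧ h (q + t • v) = 0 := by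
    intro τ hτ
    have hτε : |τ| ≤ ε := by rw [abs_of_nonneg hτ.1]; exact hτ.2.trans (min_le_right _ _)
    have hτδ : Q τ := hδQ τ (by
      rw [mem_ball_zero_iff, Real.norm_eq_abs, abs_of_nonneg hτ.1]
      have := hτ.2.trans (min_le_left _ _)
      linarith)
    obtain ⟨g1, g2⟩ := hPQ hqP hτδ
    have hc : ContinuousOn (fun s : ℝ => ρ (G s (q, τ))) (Set.Icc (-ε) ε) := by
      intro s hs
      have hin : G s (q, τ) ∈ Metric.ball p r :=
        hrect (s + τ * Complex.I) (by simpa using abs_le.2 hs) (by simpa using hτε)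
      have hc' : Continuous fun s : ℝ => G s (q, τ) := by simp only [hG]; fun_prop
      exact (ContinuousAt.comp (f := fun s : ℝ => G s (q, τ)) (g := ρ) (hball _ hin).2.1
        hc'.continuousAt).continuousWithinAt
    obtain ⟨s, hs, hs0⟩ := intermediate_value_Icc (by linarith) hc ⟨g2.le, g1.le⟩
    have hin : G s (q, τ) ∈ Metric.ball p r :=
      hrect (s + τ * Complex.I) (by simpa using abs_le.2 hs) (by simpa using hτε)
    exact ⟨s + τ * Complex.I, by simpa using abs_le.2 hs, by simp, (hball _ hin).2.2 hs0⟩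
  set K : Set ℂ := Set.Icc (-ε) ε ×ℂ Set.Icc (-ε) ε with hK
  have hKc : IsCompact K := isCompact_Icc.reProdIm isCompact_Icc
  set Z : Set ℂ := {t ∈ K | h (q + t • v) = 0} with hZ
  -- The zeros found at different heights have different imaginary parts.
  have hZinf : Z.Infinite := by
    refine Set.Infinite.of_image Complex.im ((Set.Icc_infinite hηpos).mono ?_)
    intro τ hτ
    obtain ⟨t, ht1, ht2, ht3⟩ := hzero τ hτ
    have hτε : |τ| ≤ ε := by rw [abs_of_nonneg hτ.1]; exact hτ.2.trans (min_le_right _ _)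
    exact ⟨t, ⟨⟨abs_le.1 ht1, by simpa [ht2] using abs_le.1 hτε⟩, ht3⟩, ht2⟩
  obtain ⟨a, haK, ha⟩ := hZinf.exists_accPt_of_subset_isCompact hKc (Set.sep_subset _ _)
  have hfreq : ∃ᶠ t in 𝓝[≠] a, h (q + t • v) = 0 :=
    (accPt_iff_frequently_nhdsNE.1 ha).mono fun t ht => ht.2
  have haS : a ∈ S := hrect a (abs_le.2 haK.1) (abs_le.2 haK.2)
  have h0S : (0 : ℂ) ∈ S := hrect 0 (by simpa using hε.le) (by simpa using hε.le)
  -- The zeros accumulate at `a`, so `h` vanishes on the whole slice `S`; the parameter 0 is `q`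
  -- itself.
  simpa using hk.eqOn_zero_of_preconnected_of_frequently_eq_zero hSc.isPreconnected haS hfreq h0S

/-! ### Real and complex differentials on manifolds -/

section ComplexManifold

variable {E : Type*} [NormedAddCommGroup E] [NormedSpace ℂ E]
  {M : Type*} [TopologicalSpace M] [ChartedSpace E M]
  {F : Type*} [NormedAddCommGroup F] [NormedSpace ℂ F]
  {N : Type*} [TopologicalSpace N] [ChartedSpace F N]

/-- A holomorphic map is real differentiable. -/
theorem MDifferentiableAt.real_of_complex {f : M → N} {p : M}
    (hf : MDifferentiableAt 𝓘(ℂ, E) 𝓘(ℂ, F) f p) :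
    MDifferentiableAt 𝓘(ℝ, E) 𝓘(ℝ, F) f p := by
  rw [mdifferentiableAt_iff] at hf ⊢
  exact ⟨hf.1, hf.2.restrictScalars ℝ⟩

/-- The real differential of a holomorphic map commutes with the complex structures. -/
theorem MDifferentiableAt.mfderiv_complexStructure {f : M → N} {p : M}
    (hf : MDifferentiableAt 𝓘(ℂ, E) 𝓘(ℂ, F) f p) (v : TangentSpace 𝓘(ℝ, E) p) :
    mfderiv 𝓘(ℝ, E) 𝓘(ℝ, F) f p (complexStructure p v) =
      complexStructure (f p) (mfderiv 𝓘(ℝ, E) 𝓘(ℝ, F) f p v) := by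
  have hr := hf.real_of_complex
  rw [mdifferentiableAt_iff] at hf
  have hd : DifferentiableAt ℂ (writtenInExtChartAt 𝓘(ℂ, E) 𝓘(ℂ, F) p f)
      (extChartAt 𝓘(ℂ, E) p p) := by
    simpa [differentiableWithinAt_univ] using hf.2
  have hm : mfderiv 𝓘(ℝ, E) 𝓘(ℝ, F) f p =
      (fderiv ℂ (writtenInExtChartAt 𝓘(ℂ, E) 𝓘(ℂ, F) p f)
        (extChartAt 𝓘(ℂ, E) p p)).restrictScalars ℝ := by
    rw [hr.mfderiv, ← hd.fderiv_restrictScalars ℝ]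
    simp only [modelWithCornersSelf_coe, Set.range_id, fderivWithin_univ]
    rfl
  rw [hm]
  exact (fderiv ℂ (writtenInExtChartAt 𝓘(ℂ, E) 𝓘(ℂ, F) p f)
    (extChartAt 𝓘(ℂ, E) p p)).map_smul Complex.I v

/-- A real differentiable map whose differential commutes with the complex structures is
complex differentiable. -/
theorem MDifferentiableAt.complex_of_real {f : M → N} {p : M}
    (hf : MDifferentiableAt 𝓘(ℝ, E) 𝓘(ℝ, F) f p)
    (hJ : ∀ v : TangentSpace 𝓘(ℝ, E) p, mfderiv 𝓘(ℝ, E) 𝓘(ℝ, F) f p (complexStructure p v) =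
      complexStructure (f p) (mfderiv 𝓘(ℝ, E) 𝓘(ℝ, F) f p v)) :
    MDifferentiableAt 𝓘(ℂ, E) 𝓘(ℂ, F) f p := by
  have hm := hf.mfderiv
  rw [mdifferentiableAt_iff] at hf ⊢
  refine ⟨hf.1, ?_⟩
  set k : E → F := writtenInExtChartAt 𝓘(ℂ, E) 𝓘(ℂ, F) p f with hk
  set x : E := extChartAt 𝓘(ℂ, E) p p with hx
  have hd : DifferentiableAt ℝ k x := by
    rw [← differentiableWithinAt_univ]
    have h2 := hf.2
    rw [modelWithCornersSelf_coe, Set.range_id] at h2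
    exact h2
  set D : E →L[ℝ] F := fderiv ℝ k x with hD
  have hmD : mfderiv 𝓘(ℝ, E) 𝓘(ℝ, F) f p = D := by
    rw [hm]
    simp only [modelWithCornersSelf_coe, Set.range_id, fderivWithin_univ]
    rfl
  have hI : ∀ v : E, D (Complex.I • v) = Complex.I • D v := by
    intro v
    have := hJ v
    rw [hmD] at this
    exact this
  have hsmul : ∀ (c : ℂ) (v : E), D (c • v) = c • D v := by
    intro c v
    rw [← Complex.re_add_im c, add_smul, add_smul, mul_smul, mul_smul, map_add,
      Complex.coe_smul, Complex.coe_smul, Complex.coe_smul, Complex.coe_smul, map_smul, map_smul,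
      hI]
  have : DifferentiableAt ℂ k x :=
    (differentiableAt_iff_restrictScalars ℝ hd).2
      ⟨{ D with map_smul' := hsmul }, by ext v; rfl⟩
  exact this.differentiableWithinAt

/-- Conjugating a holomorphic map by antiholomorphic maps gives a holomorphic map. -/
theorem IsAntiholomorphic.conj {σ : M → M} {τ : N → N} (hσ : IsAntiholomorphic E σ)
    (hτ : IsAntiholomorphic F τ) {f : M → N} (hf : MDifferentiable 𝓘(ℂ, E) 𝓘(ℂ, F) f) :
    MDifferentiable 𝓘(ℂ, E) 𝓘(ℂ, F) (τ ∘ f ∘ σ) := by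
  intro p
  have h1 := hσ.1 p
  have h2 := (hf (σ p)).real_of_complex
  have h3 := hτ.1 (f (σ p))
  refine (h3.comp p (h2.comp p h1)).complex_of_real fun v => ?_
  have hc : ∀ w : TangentSpace 𝓘(ℝ, E) p, mfderiv 𝓘(ℝ, E) 𝓘(ℝ, F) (τ ∘ f ∘ σ) p w =
      mfderiv 𝓘(ℝ, F) 𝓘(ℝ, F) τ (f (σ p)) (mfderiv 𝓘(ℝ, E) 𝓘(ℝ, F) f (σ p)
        (mfderiv 𝓘(ℝ, E) 𝓘(ℝ, E) σ p w)) := by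
    intro w
    rw [mfderiv_comp (I' := 𝓘(ℝ, F)) p h3 (h2.comp p h1),
      mfderiv_comp (I' := 𝓘(ℝ, E)) p h2 h1]
    rfl
  -- The two signs, one from each antiholomorphic map, cancel.
  rw [hc, hc, hσ.2, map_neg, (hf (σ p)).mfderiv_complexStructure, map_neg, hτ.2, neg_neg]
  rfl

variable [IsManifold 𝓘(ℂ, E) ω M] [IsManifold 𝓘(ℂ, F) ω N]

/-! ### Identity theorems on complex manifolds -/

/-- Near a point where two holomorphic maps agree, their coincidence set is, in a chart, the zero
set of a holomorphic map on a convex open set. -/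
theorem exists_chart_coincidence {f g : M → N}
    (hf : MDifferentiable 𝓘(ℂ, E) 𝓘(ℂ, F) f) (hg : MDifferentiable 𝓘(ℂ, E) 𝓘(ℂ, F) g) {x : M}
    (hfg : f x = g x) :
    ∃ (W : Set E) (h : E → F), IsOpen W ∧ Convex ℝ W ∧ chartAt E x x ∈ W ∧
      W ⊆ (chartAt E x).target ∧ DifferentiableOn ℂ h W ∧
      ∀ z ∈ W, h z = 0 ↔ f ((chartAt E x).symm z) = g ((chartAt E x).symm z) := by
  have : IsManifold 𝓘(ℂ, E) 1 M := IsManifold.of_le (n := ω) (by simp)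
  have : IsManifold 𝓘(ℂ, F) 1 N := IsManifold.of_le (n := ω) (by simp)
  set φ := chartAt E x with hφ
  set ψ := chartAt F (f x) with hψ
  have hs : MDifferentiableOn 𝓘(ℂ, E) 𝓘(ℂ, E) φ.symm φ.target := by
    simpa using mdifferentiableOn_atlas_symm (I := 𝓘(ℂ, E)) (chart_mem_atlas E x)
  have hψd : MDifferentiableOn 𝓘(ℂ, F) 𝓘(ℂ, F) ψ ψ.source :=
    mdifferentiableOn_atlas (I := 𝓘(ℂ, F)) (chart_mem_atlas F (f x))
  have hxt : φ x ∈ φ.target := mem_chart_target E x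
  have hO : IsOpen (f ⁻¹' ψ.source ∩ g ⁻¹' ψ.source) :=
    (ψ.open_source.preimage hf.continuous).inter (ψ.open_source.preimage hg.continuous)
  have hO' : IsOpen (φ.target ∩ φ.symm ⁻¹' (f ⁻¹' ψ.source ∩ g ⁻¹' ψ.source)) :=
    φ.symm.isOpen_inter_preimage hO
  have hxO : φ x ∈ φ.target ∩ φ.symm ⁻¹' (f ⁻¹' ψ.source ∩ g ⁻¹' ψ.source) := by
    refine ⟨hxt, ?_⟩
    rw [Set.mem_preimage, φ.left_inv (mem_chart_source E x)]
    exact ⟨mem_chart_source F (f x), by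
      rw [Set.mem_preimage, ← hfg]; exact mem_chart_source F (f x)⟩
  obtain ⟨r, hr, hW⟩ := Metric.isOpen_iff.1 hO' _ hxO
  have key : ∀ k : M → N, MDifferentiable 𝓘(ℂ, E) 𝓘(ℂ, F) k →
      (∀ z ∈ Metric.ball (φ x) r, k (φ.symm z) ∈ ψ.source) →
      DifferentiableOn ℂ (fun z => ψ (k (φ.symm z))) (Metric.ball (φ x) r) := by
    intro k hk hks
    rw [← mdifferentiableOn_iff_differentiableOn]
    exact hψd.comp (hk.comp_mdifferentiableOn (hs.mono fun z hz => (hW hz).1)) hks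
  refine ⟨Metric.ball (φ x) r, fun z => ψ (f (φ.symm z)) - ψ (g (φ.symm z)), Metric.isOpen_ball,
    convex_ball _ _, Metric.mem_ball_self hr, fun z hz => (hW hz).1,
    (key f hf fun z hz => (hW hz).2.1).sub (key g hg fun z hz => (hW hz).2.2), fun z hz => ?_⟩
  rw [sub_eq_zero]
  exact ψ.injOn.eq_iff (hW hz).2.1 (hW hz).2.2

/-- Identity theorem: holomorphic maps on a connected complex manifold that agree near one point
are equal. -/
theorem MDifferentiable.eq_of_eventuallyEq_complex [CompleteSpace F] [PreconnectedSpace M]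
    [T2Space N] {f g : M → N} (hf : MDifferentiable 𝓘(ℂ, E) 𝓘(ℂ, F) f)
    (hg : MDifferentiable 𝓘(ℂ, E) 𝓘(ℂ, F) g) {x₀ : M} (h₀ : f =ᶠ[𝓝 x₀] g) : f = g := by
  set A : Set M := {x | f =ᶠ[𝓝 x] g} with hA
  have hAo : IsOpen A := isOpen_setOfPred_eventually_nhds
  -- A chart neighbourhood of a limit point contains a point of `A`; convexity of its image carries
  -- the vanishing back to the limit point.
  have hAc : IsClosed A := by
    refine isClosed_of_closure_subset fun x hx => ?_
    have hfg : f x = g x :=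
      closure_minimal (fun y (hy : f =ᶠ[𝓝 y] g) => hy.self_of_nhds)
        (isClosed_eq hf.continuous hg.continuous) hx
    obtain ⟨W, h, hWo, hWc, hxW, hWt, hd, hz⟩ := exists_chart_coincidence hf hg hfg
    set φ := chartAt E x with hφ
    have hV : IsOpen (φ.source ∩ φ ⁻¹' W) := φ.isOpen_inter_preimage hWo
    obtain ⟨y, ⟨hys, hyW⟩, hyA⟩ := mem_closure_iff.1 hx _ hV ⟨mem_chart_source E x, hxW⟩
    have hy0 : h =ᶠ[𝓝 (φ y)] 0 := by
      have ht : Filter.Tendsto φ.symm (𝓝 (φ y)) (𝓝 y) := by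
        have := (φ.symm.continuousAt (x := φ y) (φ.map_source hys)).tendsto
        rwa [φ.left_inv hys] at this
      filter_upwards [ht.eventually hyA, hWo.mem_nhds hyW] with z hz1 hz2
      exact (hz z hz2).2 hz1
    have hall := hd.eqOn_zero_of_convex_of_eventuallyEq_zero hWo hWc hyW hy0
    filter_upwards [hV.mem_nhds ⟨mem_chart_source E x, hxW⟩] with w hw
    simpa only [φ.left_inv hw.1] using (hz _ hw.2).1 (hall hw.2)
  have hAu : A = Set.univ := IsClopen.eq_univ ⟨hAc, hAo⟩ ⟨x₀, h₀⟩
  funext x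
  have hx : x ∈ A := hAu ▸ Set.mem_univ x
  exact Filter.EventuallyEq.eq_of_nhds hx

/-- Holomorphic maps that agree on a real hypersurface agree near each of its points. -/
theorem IsRealHypersurface.eventuallyEq [CompleteSpace F] {H : Set M}
    (hH : IsRealHypersurface E H) {f g : M → N} (hf : MDifferentiable 𝓘(ℂ, E) 𝓘(ℂ, F) f)
    (hg : MDifferentiable 𝓘(ℂ, E) 𝓘(ℂ, F) g) (hfg : Set.EqOn f g H) {p : M} (hp : p ∈ H) :
    f =ᶠ[𝓝 p] g := by
  obtain ⟨U, ρ, hUo, hpU, hρ, hρ', hUH⟩ := hH p hp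
  obtain ⟨W, h, hWo, hWc, hxW, hWt, hd, hz⟩ := exists_chart_coincidence hf hg (hfg hp)
  set φ := chartAt E p with hφ
  have hps : p ∈ φ.source := mem_chart_source E p
  have hVo : IsOpen (φ.target ∩ φ.symm ⁻¹' U) := φ.symm.isOpen_inter_preimage hUo
  have hpV : φ p ∈ φ.target ∩ φ.symm ⁻¹' U :=
    ⟨mem_chart_target E p, by rwa [Set.mem_preimage, φ.left_inv hps]⟩
  have hρp : MDifferentiableAt 𝓘(ℝ, E) 𝓘(ℝ, ℝ) ρ p :=
    (hρ.contMDiffAt (hUo.mem_nhds hpU)).mdifferentiableAt (by simp)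
  -- `mfderiv` is by definition the derivative in the preferred chart, so nonvanishing transfers
  -- unchanged.
  have hder : HasFDerivAt (ρ ∘ φ.symm)
      (mfderiv 𝓘(ℝ, E) 𝓘(ℝ, ℝ) ρ p : E →L[ℝ] ℝ) (φ p) := by
    have := hρp.hasMFDerivAt.2
    rw [modelWithCornersSelf_coe, Set.range_id] at this
    exact hasFDerivWithinAt_univ.1 this
  have hev : h =ᶠ[𝓝 (φ p)] 0 := by
    refine eventuallyEq_zero_of_vanishing_on_hypersurface (ρ := ρ ∘ φ.symm) ?_ ?_ hder
      (hρ' p hpU) ?_ ?_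
    · filter_upwards [hWo.mem_nhds hxW] with q hq
      exact hd.differentiableAt (hWo.mem_nhds hq)
    · filter_upwards [hVo.mem_nhds hpV] with q hq
      exact ContinuousAt.comp (hρ.continuousOn.continuousAt (hUo.mem_nhds hq.2))
        (φ.symm.continuousAt hq.1)
    · simpa [φ.left_inv hps] using (hUH p hpU).1 hp
    · filter_upwards [hWo.mem_nhds hxW, hVo.mem_nhds hpV] with q hq hqV hq0
      exact (hz q hq).2 (hfg ((hUH _ hqV.2).2 hq0))
  have hφc : Filter.Tendsto φ (𝓝 p) (𝓝 (φ p)) := φ.continuousAt hps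
  filter_upwards [hφc.eventually hev, hφc.eventually (hWo.mem_nhds hxW),
    φ.open_source.mem_nhds hps] with q hq hqW hqs
  simpa only [φ.left_inv hqs] using (hz _ hqW).1 hq

end ComplexManifold

theorem theorem6p1
    {E : Type*} [NormedAddCommGroup E] [NormedSpace ℂ E] [FiniteDimensional ℂ E]
    {M : Type*} [TopologicalSpace M] [T2Space M] [ChartedSpace E M] [IsManifold 𝓘(ℂ, E) ω M]
    {F : Type*} [NormedAddCommGroup F] [NormedSpace ℂ F] [FiniteDimensional ℂ F]
    {N : Type*} [TopologicalSpace N] [T2Space N] [ChartedSpace F N] [IsManifold 𝓘(ℂ, F) ω N]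
    (gM : SmoothRiemannianMetric E M) (hM : IsHermitianSymmetric gM)
    (gN : SmoothRiemannianMetric F N) (hN : IsHermitianSymmetric gN)
    (σ₁ : M → M) (B₁ : Set M) (hB₁ : IsRealForm gM σ₁ B₁)
    (σ₂ : N → N) (B₂ : Set N) (hB₂ : IsRealForm gN σ₂ B₂)
    (f : M → N) (hf : MDifferentiable 𝓘(ℂ, E) 𝓘(ℂ, F) f)
    (hfB : f '' B₁ ⊆ B₂)
    (H : Set M) (hH : IsRealHypersurface E H) (hHne : H.Nonempty)
    (hBH : B₁ ⊆ H) (hσH : σ₁ '' H = H)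
    (h1 : ∀ p ∈ H, f (σ₁ p) = σ₂ (f p))
    (h2 : ∀ p ∈ H, ∀ v : TangentSpace 𝓘(ℝ, E) p, v ∈ submanifoldTangentSpace H p →
      tangentMap 𝓘(ℝ, E) 𝓘(ℝ, F) f (tangentMap 𝓘(ℝ, E) 𝓘(ℝ, E) σ₁ ⟨p, v⟩) =
        tangentMap 𝓘(ℝ, F) 𝓘(ℝ, F) σ₂ (tangentMap 𝓘(ℝ, E) 𝓘(ℝ, F) f ⟨p, v⟩)) :
    ∀ p : M, f (σ₁ p) = σ₂ (f p) := by
  have : CompleteSpace F := FiniteDimensional.complete ℂ F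
  have := hM.connected
  obtain ⟨p₀, hp₀⟩ := hHne
  have hconj := hB₁.antiholomorphic.conj hB₂.antiholomorphic hf
  -- Apply `σ₂` to condition 1 and use `σ₂ ∘ σ₂ = id`; the same cancellation ends the proof.
  have hEq : Set.EqOn f (σ₂ ∘ f ∘ σ₁) H := fun p hp => by
    rw [Function.comp_apply, Function.comp_apply, h1 p hp]
    exact (hB₂.involutiveIsometry.involutive (f p)).symm
  have hfg := hf.eq_of_eventuallyEq_complex hconj (hH.eventuallyEq hf hconj hEq hp₀)
  intro p
  conv_rhs => rw [hfg]
  exact (hB₂.involutiveIsometry.involutive (f (σ₁ p))).symm
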